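/- Let $\mu$ be Lebesgue measure on $[0,1]$. For a real normed space $X$ with closed unit ball $B_X$, unit sphere $S_X$ and dual $X^*$, a slice of $B_X$ is a set $S(x^*,\alpha)=\{y\in B_X:\ x^*(y)>\sup x^*(B_X)-\alpha\}$ with $x^*\in X^*$ and $\alpha>0$. For $x\in S_X$ let $D(x)=\{x^*\in S_{X^*}:\ x^*(x)=1\}$. A point $x\in S_X$ is called a Daugavet-point if $\sup_{y\in S}\|x-y\|=2$ for every slice $S$ of $B_X$; a $\Delta$-point if this holds for every slice $S$ of $B_X$ with $x\in S$; and a $\mathfrak{D}$-point if this holds for every slice $S=S(x^*,\alpha)$ with $x^*\in D(x)$ and $\alpha>0$. **Proposition.** Let $X$ be a linear subspace of the real Banach space $L_1[0,1]$ (in particular, any closed subspace), with the norm of $L_1[0,1]$. 1. If $f\in S_X$ is a $\mathfrak{D}$-point of $X$ and $h\in D(f)$, then for all $\varepsilon>0$, $\delta>0$ and $\gamma>0$ there exist a measurable set $D\subseteq[0,1]$ with $\mu(D)<\delta$ and some $g\in S(h,\gamma)$ such that $$\int_D |g|\,d\mu>1-\varepsilon.$$ 2. If $X$ is reflexive, then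 $X$ has no $\mathfrak{D}$-points, and hence neither $\Delta$-points nor Daugavet-points. -/

import Mathlib

open MeasureTheory

/-- The real Banach space `L_1[0,1]`, for Lebesgue measure on the unit interval. -/
abbrev LOneUnit : Type := Lp ℝ 1 (volume : Measure unitInterval)

section SlicePoints

variable {E : Type*} [NormedAddCommGroup E] [NormedSpace ℝ E]

/-- The slice `S(x*, α)` of the closed unit ball `B_E`:
all `y ∈ B_E` with `x*(y) > sup x*(B_E) - α`. -/
def ballSlice (φ : StrongDual ℝ E) (α : ℝ) : Set E :=
  {y | y ∈ Metric.closedBall (0 : E) 1 ∧ sSup (φ '' Metric.closedBall (0 : E) 1) - α < φ y}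

/-- The set `D(x)` of norm-one functionals supporting the unit ball at `x`. -/
def supportingFunctionals (x : E) : Set (StrongDual ℝ E) :=
  {φ | ‖φ‖ = 1 ∧ φ x = 1}

/-- `x ∈ S_E` and `sup_{y ∈ S} ‖x - y‖ = 2` for every slice `S` of `B_E`. -/
def IsDaugavetPoint (x : E) : Prop :=
  ‖x‖ = 1 ∧ ∀ (φ : StrongDual ℝ E) (α : ℝ), 0 < α →
    IsLUB ((fun y => ‖x - y‖) '' ballSlice φ α) 2

/-- `x ∈ S_E` and `sup_{y ∈ S} ‖x - y‖ = 2` for every slice `S` of `B_E` containing `x`. -/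
def IsDeltaPoint (x : E) : Prop :=
  ‖x‖ = 1 ∧ ∀ (φ : StrongDual ℝ E) (α : ℝ), 0 < α → x ∈ ballSlice φ α →
    IsLUB ((fun y => ‖x - y‖) '' ballSlice φ α) 2

/-- `𝔇`-point: `x ∈ S_E` and `sup_{y ∈ S} ‖x - y‖ = 2` for every slice `S` of `B_E`
defined by a functional in `D(x)`. -/
def IsFrakDPoint (x : E) : Prop :=
  ‖x‖ = 1 ∧ ∀ φ ∈ supportingFunctionals x, ∀ α : ℝ, 0 < α →
    IsLUB ((fun y => ‖x - y‖) '' ballSlice φ α) 2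

/-- A normed space is reflexive if the canonical map into its bidual is surjective
(completeness is then automatic, since the canonical map is an isometry). -/
def IsReflexiveSpace (E : Type*) [NormedAddCommGroup E] [NormedSpace ℝ E] : Prop :=
  Function.Surjective (NormedSpace.inclusionInDoubleDual ℝ E)

end SlicePoints

open Filter Topology

/-! ### Supporting functionals, slices and weak compactness. -/

section SlicePointRelations

variable {E : Type*} [NormedAddCommGroup E] [NormedSpace ℝ E]

/-! Extend `h` to `L¹` by Hahn–Banach and cut the extension off to the support `A` of `f`; it still
supports the ball at `f`. The `𝔇`-property then gives `g` with most of its mass on `A` and both `‖f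
+ g‖` and `‖f - g‖` near 2, so `∫ min |f| |g|` is tiny (`two_mul_integral_min_abs`). Hence on `A`
the mass of `g` sits almost entirely where `f` is small or where both are large, two sets of small
measure. In a reflexive subspace, such functions with concentration sets of summable measure have a
weak limit that keeps mass at least 1/2 on sets of arbitrarily small measure, contradicting
integrability. -/

lemma sSup_image_closedBall_of_mem_supportingFunctionals {x : E} {φ : StrongDual ℝ E}
    (hx : ‖x‖ = 1) (hφ : φ ∈ supportingFunctionals x) :
    sSup (φ '' Metric.closedBall (0 : E) 1) = 1 := by
  refine IsGreatest.csSup_eq ⟨⟨x, by simp [hx], hφ.2⟩, ?_⟩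
  rintro _ ⟨y, hy, rfl⟩
  rw [mem_closedBall_zero_iff] at hy
  calc φ y ≤ ‖φ y‖ := le_abs_self _
    _ ≤ ‖φ‖ * ‖y‖ := φ.le_opNorm y
    _ ≤ 1 := by rw [hφ.1, one_mul]; exact hy

lemma mem_ballSlice_iff_of_mem_supportingFunctionals {x : E} {φ : StrongDual ℝ E}
    (hx : ‖x‖ = 1) (hφ : φ ∈ supportingFunctionals x) {α : ℝ} {y : E} :
    y ∈ ballSlice φ α ↔ ‖y‖ ≤ 1 ∧ 1 - α < φ y := by
  simp only [ballSlice, Set.mem_ofPred_eq,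
    sSup_image_closedBall_of_mem_supportingFunctionals hx hφ, mem_closedBall_zero_iff]

lemma supportingFunctionals_nonempty {x : E} (hx : ‖x‖ = 1) :
    (supportingFunctionals x).Nonempty := by
  obtain ⟨φ, hφ, hφx⟩ := exists_dual_vector ℝ x (by simp [hx])
  exact ⟨φ, hφ, by simpa [hx] using hφx⟩

lemma IsDaugavetPoint.isDeltaPoint {x : E} (h : IsDaugavetPoint x) : IsDeltaPoint x :=
  ⟨h.1, fun φ α hα _ => h.2 φ α hα⟩

lemma IsDeltaPoint.isFrakDPoint {x : E} (h : IsDeltaPoint x) : IsFrakDPoint x := by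
  refine ⟨h.1, fun φ hφ α hα => h.2 φ α hα ?_⟩
  rw [mem_ballSlice_iff_of_mem_supportingFunctionals h.1 hφ, hφ.2]
  exact ⟨h.1.le, by linarith⟩

lemma IsFrakDPoint.exists_far_mem_slice {x : E} (hx : IsFrakDPoint x) {φ : StrongDual ℝ E}
    (hφ : φ ∈ supportingFunctionals x) {η : ℝ} (hη : 0 < η) :
    ∃ y : E, ‖y‖ ≤ 1 ∧ 1 - η < φ y ∧ 2 - η < ‖x - y‖ := by
  obtain ⟨_, ⟨y, hy, rfl⟩, hlt⟩ :=
    (lt_isLUB_iff (hx.2 φ hφ η hη)).1 (show 2 - η < 2 by linarith)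
  rw [mem_ballSlice_iff_of_mem_supportingFunctionals hx.1 hφ] at hy
  exact ⟨y, hy.1, hy.2, hlt⟩

/-- A bounded sequence in a reflexive space has a weak limit along some ultrafilter. -/
lemma IsReflexiveSpace.exists_weak_limit (hE : IsReflexiveSpace E) {u : ℕ → E}
    (hu : ∀ n, ‖u n‖ ≤ 1) :
    ∃ (U : Ultrafilter ℕ) (x : E), (U : Filter ℕ) ≤ atTop ∧
      ∀ φ : StrongDual ℝ E, Tendsto (fun n => φ (u n)) U (𝓝 (φ x)) := by
  let J : ℕ → WeakDual ℝ (StrongDual ℝ E) := fun n =>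
    StrongDual.toWeakDual (NormedSpace.inclusionInDoubleDual ℝ E (u n))
  have hJ : ∀ n, J n ∈ WeakDual.toStrongDual ⁻¹'
      Metric.closedBall (0 : StrongDual ℝ (StrongDual ℝ E)) 1 := fun n => by
    refine (mem_closedBall_zero_iff (E := StrongDual ℝ (StrongDual ℝ E))).2 ?_
    exact (NormedSpace.double_dual_bound ℝ E (u n)).trans (hu n)
  -- Banach–Alaoglu in the bidual; reflexivity then brings the limit back to the space.
  obtain ⟨Φ, -, hΦ⟩ := (WeakDual.isCompact_closedBall (𝕜 := ℝ)
    (0 : StrongDual ℝ (StrongDual ℝ E)) 1).ultrafilter_le_nhds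
      ((hyperfilter ℕ).map J) (le_principal_iff.2 (mem_map.2 (univ_mem' hJ)))
  obtain ⟨x, hx⟩ := hE (WeakDual.toStrongDual Φ)
  refine ⟨hyperfilter ℕ, x, Nat.hyperfilter_le_atTop, fun φ => ?_⟩
  have h1 : Tendsto (fun n => J n φ) (hyperfilter ℕ) (𝓝 (Φ φ)) :=
    ((WeakDual.eval_continuous φ).tendsto Φ).comp hΦ
  have h2 : Φ φ = φ x := by
    rw [← NormedSpace.dual_def ℝ E x φ, hx]; rfl
  rw [← h2]
  exact h1

end SlicePointRelations

/-! ### Restriction, almost disjointness and concentration in `L¹`. -/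

section LOneRestriction

variable {α : Type*} [MeasurableSpace α] {μ : Measure α}

/-- Multiplication by the indicator of a measurable set, as an operator on `L¹`. -/
noncomputable def indicatorLOne (s : Set α) (hs : MeasurableSet s) :
    Lp ℝ 1 μ →L[ℝ] Lp ℝ 1 μ :=
  LinearMap.mkContinuous
    { toFun := fun u => ((L1.integrable_coeFn u).indicator hs).toL1 _
      map_add' := fun u v => by
        rw [← Integrable.toL1_add, Integrable.toL1_eq_toL1_iff]
        filter_upwards [Lp.coeFn_add u v] with t ht
        by_cases hts : t ∈ s
        · simpa only [Set.indicator_of_mem hts, Pi.add_apply] using ht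
        · simp [hts]
      map_smul' := fun c u => by
        rw [RingHom.id_apply, ← Integrable.toL1_smul, Integrable.toL1_eq_toL1_iff]
        filter_upwards [Lp.coeFn_smul c u] with t ht
        by_cases hts : t ∈ s
        · simpa only [Set.indicator_of_mem hts, Pi.smul_apply] using ht
        · simp [hts] }
    1 fun u => by
      simp only [LinearMap.coe_mk, AddHom.coe_mk, one_mul]
      rw [L1.norm_of_fun_eq_integral_norm ((L1.integrable_coeFn u).indicator hs), L1.norm_eq_integral_norm]
      exact integral_mono ((L1.integrable_coeFn u).indicator hs).norm (L1.integrable_coeFn u).norm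
        fun t => norm_indicator_le_norm_self _ _

lemma indicatorLOne_coeFn {s : Set α} (hs : MeasurableSet s) (u : Lp ℝ 1 μ) :
    indicatorLOne s hs u =ᵐ[μ] s.indicator u :=
  Integrable.coeFn_toL1 ((L1.integrable_coeFn u).indicator hs)

lemma norm_indicatorLOne {s : Set α} (hs : MeasurableSet s) (u : Lp ℝ 1 μ) :
    ‖indicatorLOne s hs u‖ = ∫ t in s, |u t| ∂μ := by
  rw [L1.norm_eq_integral_norm, ← integral_indicator hs]
  refine integral_congr_ae ?_
  filter_upwards [indicatorLOne_coeFn hs u] with t ht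
  rw [ht, norm_indicator_eq_indicator_norm]
  rfl

lemma indicatorLOne_add_compl {s : Set α} (hs : MeasurableSet s) (u : Lp ℝ 1 μ) :
    indicatorLOne s hs u + indicatorLOne sᶜ hs.compl u = u := by
  refine Lp.ext ?_
  filter_upwards [Lp.coeFn_add (indicatorLOne s hs u) (indicatorLOne sᶜ hs.compl u),
    indicatorLOne_coeFn hs u, indicatorLOne_coeFn hs.compl u] with t h1 h2 h3
  rw [h1, Pi.add_apply, h2, h3, Set.indicator_self_add_compl_apply]

lemma setIntegral_abs_add_compl {s : Set α} (hs : MeasurableSet s) (u : Lp ℝ 1 μ) :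
    ∫ t in s, |u t| ∂μ + ∫ t in sᶜ, |u t| ∂μ = ‖u‖ := by
  rw [integral_add_compl hs (L1.integrable_coeFn u).abs, L1.norm_eq_integral_norm]
  rfl

lemma apply_indicatorLOne_le {s : Set α} (hs : MeasurableSet s) {H : StrongDual ℝ (Lp ℝ 1 μ)}
    (hH : ‖H‖ ≤ 1) (u : Lp ℝ 1 μ) : |H (indicatorLOne s hs u)| ≤ ∫ t in s, |u t| ∂μ := by
  rw [← norm_indicatorLOne hs u]
  simpa using H.le_of_opNorm_le hH (indicatorLOne s hs u)

lemma indicatorLOne_support (u : Lp ℝ 1 μ) (hs : MeasurableSet {t | u t ≠ 0}) :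
    indicatorLOne {t | u t ≠ 0} hs u = u := by
  refine Lp.ext ((indicatorLOne_coeFn hs u).trans (Eventually.of_forall fun t => ?_))
  by_cases ht : u t = 0 <;> simp [Set.indicator, ht]

lemma integrable_min_abs (u v : Lp ℝ 1 μ) : Integrable (fun t => min |u t| |v t|) μ :=
  (L1.integrable_coeFn u).abs.inf (L1.integrable_coeFn v).abs

/-- Pointwise, `|a + b| + |a - b| = 2 max |a| |b| = 2 (|a| + |b|) - 2 min |a| |b|`. -/
lemma two_mul_integral_min_abs (u v : Lp ℝ 1 μ) :
    2 * ∫ t, min |u t| |v t| ∂μ = 2 * (‖u‖ + ‖v‖) - (‖u + v‖ + ‖u - v‖) := by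
  have hu := (L1.integrable_coeFn u).abs
  have hv := (L1.integrable_coeFn v).abs
  have ha := (L1.integrable_coeFn (u + v)).abs
  have hb := (L1.integrable_coeFn (u - v)).abs
  simp only [L1.norm_eq_integral_norm, Real.norm_eq_abs]
  rw [← integral_add hu hv, ← integral_add ha hb, ← integral_const_mul, ← integral_const_mul,
    ← integral_sub (f := fun t => 2 * (|u t| + |v t|))
      (g := fun t => |(u + v) t| + |(u - v) t|) ((hu.add hv).const_mul 2) (ha.add hb)]
  refine integral_congr_ae ?_
  filter_upwards [Lp.coeFn_add u v, Lp.coeFn_sub u v] with t h1 h2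
  rw [h1, h2, Pi.add_apply, Pi.sub_apply]
  rcases abs_cases (u t) with h | h <;> rcases abs_cases (v t) with h' | h' <;>
    rcases abs_cases (u t + v t) with h3 | h3 <;> rcases abs_cases (u t - v t) with h4 | h4 <;>
    rcases min_cases |u t| |v t| with h5 | h5 <;> linarith

/-- The set where a function is nonzero but small has small measure. -/
lemma exists_measure_nonzero_abs_le_lt [IsFiniteMeasure μ] {u : α → ℝ} (hu : Measurable u)
    {ε : ENNReal} (hε : 0 < ε) : ∃ c : ℝ, 0 < c ∧ μ {t | u t ≠ 0 ∧ |u t| ≤ c} < ε := by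
  let s : ℕ → Set α := fun n => {t | u t ≠ 0 ∧ |u t| ≤ 1 / ((n : ℝ) + 1)}
  have hs : ∀ n, MeasurableSet (s n) := fun n =>
    ((measurableSet_singleton (0 : ℝ)).compl.preimage hu).inter
      (measurableSet_le hu.abs measurable_const)
  have hanti : Antitone s := fun m n hmn t ht =>
    ⟨ht.1, ht.2.trans (one_div_le_one_div_of_le (by positivity) (by gcongr))⟩
  have hempty : ⋂ n, s n = ∅ := by
    refine Set.eq_empty_of_forall_notMem fun t ht => ?_
    rw [Set.mem_iInter] at ht
    obtain ⟨n, hn⟩ := exists_nat_one_div_lt (abs_pos.2 (ht 0).1)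
    exact absurd (ht n).2 hn.not_ge
  have hlim := tendsto_measure_iInter_atTop (μ := μ) (fun n => (hs n).nullMeasurableSet) hanti
    ⟨0, measure_ne_top _ _⟩
  rw [hempty, measure_empty] at hlim
  obtain ⟨n, hn⟩ := (hlim.eventually_lt_const hε).exists
  exact ⟨1 / ((n : ℝ) + 1), by positivity, hn⟩

/-- Near a `𝔇`-point of a subspace of `L¹`, slices contain functions whose mass is concentrated
on a set of small measure. -/
theorem IsFrakDPoint.exists_concentrated_mem_slice [IsFiniteMeasure μ]
    {X : Submodule ℝ (Lp ℝ 1 μ)} {f : X} {h : StrongDual ℝ X} (hf : IsFrakDPoint f)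
    (hh : h ∈ supportingFunctionals f) {ε δ γ : ℝ} (hε : 0 < ε) (hδ : 0 < δ) (hγ : 0 < γ) :
    ∃ D : Set α, MeasurableSet D ∧ μ D < ENNReal.ofReal δ ∧
      ∃ g ∈ ballSlice h γ, 1 - ε < ∫ t in D, |(g : Lp ℝ 1 μ) t| ∂μ := by
  obtain ⟨H, hHh, hHn⟩ := exists_extension_norm_eq X h
  rw [hh.1] at hHn
  set F : Lp ℝ 1 μ := (f : Lp ℝ 1 μ) with hF
  have hFn : ‖F‖ = 1 := hf.1
  have hFm : Measurable F := (Lp.stronglyMeasurable F).measurable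
  set A : Set α := {t | F t ≠ 0} with hA
  have hAm : MeasurableSet A := (measurableSet_singleton (0 : ℝ)).compl.preimage hFm
  -- The cutoff forces near-maximisers of the functional to carry their mass on `A`.
  let H₁ : StrongDual ℝ (Lp ℝ 1 μ) := H.comp (indicatorLOne A hAm)
  have hH₁ : ∀ u, |H₁ u| ≤ ∫ t in A, |u t| ∂μ := apply_indicatorLOne_le hAm hHn.le
  have hH₁F : H₁ F = 1 := by
    change H (indicatorLOne A hAm F) = 1
    rw [indicatorLOne_support F hAm, hF, hHh, hh.2]
  have hH₁n : ∀ u, |H₁ u| ≤ ‖u‖ := fun u => (hH₁ u).trans <| by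
    rw [← setIntegral_abs_add_compl hAm u]
    exact le_add_of_nonneg_right (integral_nonneg fun _ => abs_nonneg _)
  let h₁ : StrongDual ℝ X := H₁.comp X.subtypeL
  have hh₁ : h₁ ∈ supportingFunctionals f := by
    refine ⟨le_antisymm ?_ ?_, hH₁F⟩
    · exact h₁.opNorm_le_bound zero_le_one fun u => by
        rw [one_mul]; exact hH₁n u
    · have := h₁.le_opNorm f
      rw [hf.1, mul_one, show h₁ f = 1 from hH₁F] at this
      simpa using this
  obtain ⟨c, hc, hcμ⟩ := exists_measure_nonzero_abs_le_lt (μ := μ) hFm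
    (ENNReal.ofReal_pos.2 (half_pos hδ))
  -- An error `η` is lost twice in the mass of `g` and twice in `h g`; the last bound feeds Markov's
  -- inequality at level `c`.
  obtain ⟨η, hη, hηε, hηγ, hηδ⟩ :
      ∃ η : ℝ, 0 < η ∧ 2 * η ≤ ε ∧ 2 * η ≤ γ ∧ η ≤ c * (δ / 2) := by
    refine ⟨min (ε / 2) (min (γ / 2) (c * (δ / 2))), by positivity, ?_, ?_, ?_⟩
    · linarith [min_le_left (ε / 2) (min (γ / 2) (c * (δ / 2)))]
    · linarith [min_le_right (ε / 2) (min (γ / 2) (c * (δ / 2))),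
        min_le_left (γ / 2) (c * (δ / 2))]
    · linarith [min_le_right (ε / 2) (min (γ / 2) (c * (δ / 2))),
        min_le_right (γ / 2) (c * (δ / 2))]
  obtain ⟨g, hg, hgh, hfg⟩ := hf.exists_far_mem_slice hh₁ hη
  set G : Lp ℝ 1 μ := (g : Lp ℝ 1 μ) with hG
  have hGn : ‖G‖ ≤ 1 := hg
  have hGm : Measurable G := (Lp.stronglyMeasurable G).measurable
  have hGH : 1 - η < H₁ G := hgh
  have hsub : 2 - η < ‖F - G‖ := hfg
  have hadd : 2 - η < ‖F + G‖ := by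
    have h1 := (le_abs_self _).trans (hH₁n (F + G))
    rw [map_add, hH₁F] at h1
    linarith
  have hmin : ∫ t, min |F t| |G t| ∂μ ≤ η := by
    linarith [two_mul_integral_min_abs F G]
  have hmin0 : ∀ t, 0 ≤ min |F t| |G t| := fun t => le_min (abs_nonneg _) (abs_nonneg _)
  have hAG : 1 - η < ∫ t in A, |G t| ∂μ := hGH.trans_le ((le_abs_self _).trans (hH₁ G))
  set D₁ : Set α := {t | F t ≠ 0 ∧ |F t| ≤ c} with hD₁
  set D₂ : Set α := {t | c ≤ min |F t| |G t|} with hD₂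
  have hD₁m : MeasurableSet D₁ := hAm.inter (measurableSet_le hFm.abs measurable_const)
  have hD₂m : MeasurableSet D₂ := measurableSet_le measurable_const (hFm.abs.min hGm.abs)
  have hDm : MeasurableSet (D₁ ∪ D₂) := hD₁m.union hD₂m
  have hD₂μ : μ D₂ ≤ ENNReal.ofReal (δ / 2) := by
    have h1 := mul_meas_ge_le_integral_of_nonneg (Eventually.of_forall hmin0)
      (integrable_min_abs F G) c
    have h2 : μ.real D₂ ≤ δ / 2 :=
      le_of_mul_le_mul_left (h1.trans (hmin.trans hηδ)) hc
    rw [← ofReal_measureReal (measure_ne_top μ D₂)]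
    exact ENNReal.ofReal_le_ofReal h2
  have hGi := (L1.integrable_coeFn G).abs
  have hmass : ∫ t in A, |G t| ∂μ ≤ ∫ t in D₁ ∪ D₂, |G t| ∂μ + η := by
    rw [← integral_indicator hAm, ← integral_indicator hDm]
    refine le_trans ?_ (add_le_add_right hmin _)
    rw [← integral_add (hGi.indicator hDm) (integrable_min_abs F G)]
    refine integral_mono (hGi.indicator hAm)
      ((hGi.indicator hDm).add (integrable_min_abs F G)) fun t => ?_
    by_cases htD : t ∈ D₁ ∪ D₂
    · refine (Set.indicator_le_self' (fun _ _ => abs_nonneg _) t).trans ?_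
      simp [htD]
    -- On `A` outside `D₁ ∪ D₂`, `|G| < c < |F|`, so `|G|` is the minimum.
    · by_cases htA : t ∈ A
      · have h1 : c < |F t| := by
          by_contra! hle
          exact htD (Or.inl ⟨htA, hle⟩)
        have h2 : |G t| < c := by
          by_contra! hle
          exact htD (Or.inr (le_min h1.le hle))
        simp [htA, htD, min_eq_right (h2.trans h1).le]
      · simp [htA, htD]
  refine ⟨D₁ ∪ D₂, hDm, ?_, g, ?_, by linarith⟩
  · calc μ (D₁ ∪ D₂) ≤ μ D₁ + μ D₂ := measure_union_le _ _
      _ < ENNReal.ofReal (δ / 2) + ENNReal.ofReal (δ / 2) :=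
        ENNReal.add_lt_add_of_lt_of_le (measure_ne_top _ _) hcμ hD₂μ
      _ = ENNReal.ofReal δ := by
        rw [← ENNReal.ofReal_add (half_pos hδ).le (half_pos hδ).le, add_halves]
  · rw [mem_ballSlice_iff_of_mem_supportingFunctionals hf.1 hh]
    refine ⟨hg, ?_⟩
    -- Off `A`, `G` has mass less than `η`, so `H G` exceeds `1 - 2η`.
    have h1 := congrArg H (indicatorLOne_add_compl hAm G)
    have h2 := neg_abs_le (H (indicatorLOne Aᶜ hAm.compl G))
    have h3 := apply_indicatorLOne_le hAm.compl hHn.le G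
    have h4 := setIntegral_abs_add_compl hAm G
    have h5 : 1 - η < H (indicatorLOne A hAm G) := hGH
    rw [map_add] at h1
    rw [← hHh g]
    change 1 - γ < H G
    linarith

/-- A reflexive subspace of `L¹` of a finite measure has no `𝔇`-points. -/
theorem IsReflexiveSpace.not_isFrakDPoint [IsFiniteMeasure μ] {X : Submodule ℝ (Lp ℝ 1 μ)}
    (hX : IsReflexiveSpace X) (f : X) : ¬ IsFrakDPoint f := by
  intro hf
  obtain ⟨h, hh⟩ := supportingFunctionals_nonempty hf.1
  have key : ∀ n : ℕ, ∃ D : Set α, MeasurableSet D ∧ μ D < ENNReal.ofReal ((1 / 2) ^ n) ∧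
      ∃ g ∈ ballSlice h (1 / 4), 1 - 1 / 4 < ∫ t in D, |(g : Lp ℝ 1 μ) t| ∂μ := fun n =>
    hf.exists_concentrated_mem_slice hh (by norm_num) (by positivity) (by norm_num)
  choose D hDm hDμ g hg hgD using key
  simp only [mem_ballSlice_iff_of_mem_supportingFunctionals hf.1 hh] at hg
  obtain ⟨H, hHh, hHn⟩ := exists_extension_norm_eq X h
  rw [hh.1] at hHn
  obtain ⟨U, x, hU, hlim⟩ := hX.exists_weak_limit fun n => (hg n).1
  let T : ℕ → Set α := fun N => ⋃ k, D (k + N)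
  have hTm : ∀ N, MeasurableSet (T N) := fun N => .iUnion fun k => hDm _
  have hTμ : Tendsto (fun N => μ (T N)) atTop (𝓝 0) := by
    have hsum : ∑' n : ℕ, ENNReal.ofReal ((1 / 2 : ℝ) ^ n) ≠ ⊤ := by
      rw [← ENNReal.ofReal_tsum_of_nonneg (fun n => by positivity) summable_geometric_two]
      exact ENNReal.ofReal_ne_top
    refine tendsto_of_tendsto_of_tendsto_of_le_of_le tendsto_const_nhds
      (ENNReal.tendsto_sum_nat_add _ hsum) (fun _ => zero_le) fun N => ?_
    exact (measure_iUnion_le _).trans (ENNReal.tsum_le_tsum fun k => (hDμ _).le)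
  have hint : Tendsto (fun N => ∫ t in T N, |(x : Lp ℝ 1 μ) t| ∂μ) atTop (𝓝 0) :=
    (L1.integrable_coeFn (x : Lp ℝ 1 μ)).abs.tendsto_setIntegral_nhds_zero hTμ
  have hlow : ∀ N, 1 / 2 ≤ ∫ t in T N, |(x : Lp ℝ 1 μ) t| ∂μ := by
    intro N
    refine le_trans ?_ ((le_abs_self _).trans (apply_indicatorLOne_le (hTm N) hHn.le _))
    -- For `n ≥ N`, `H (g n) > 3/4` and less than `1/4` of the mass lies off `T N`, so the bound
    -- `1/2` passes to the weak limit.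
    refine ge_of_tendsto (hlim ((H.comp (indicatorLOne (T N) (hTm N))).comp X.subtypeL)) ?_
    filter_upwards [hU (eventually_ge_atTop N)] with n hn
    change 1 / 2 ≤ H (indicatorLOne (T N) (hTm N) (g n : Lp ℝ 1 μ))
    have hDT : D n ⊆ T N := by
      have := Set.subset_iUnion (fun k => D (k + N)) (n - N)
      rwa [Nat.sub_add_cancel hn] at this
    have h0 : ∫ t in D n, |(g n : Lp ℝ 1 μ) t| ∂μ ≤ ∫ t in T N, |(g n : Lp ℝ 1 μ) t| ∂μ :=
      setIntegral_mono_set (L1.integrable_coeFn _).abs.integrableOn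
        (Eventually.of_forall fun _ => abs_nonneg _) hDT.eventuallyLE
    have h1 := congrArg H (indicatorLOne_add_compl (hTm N) (g n : Lp ℝ 1 μ))
    have h2 := le_abs_self (H (indicatorLOne (T N)ᶜ (hTm N).compl (g n : Lp ℝ 1 μ)))
    have h3 := apply_indicatorLOne_le (hTm N).compl hHn.le (g n : Lp ℝ 1 μ)
    have h4 := setIntegral_abs_add_compl (hTm N) (g n : Lp ℝ 1 μ)
    have h5 : ‖(g n : Lp ℝ 1 μ)‖ ≤ 1 := (hg n).1
    have h6 := (hg n).2
    have h7 := hgD n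
    rw [map_add, hHh] at h1
    linarith
  have := ge_of_tendsto' hint hlow
  norm_num at this

end LOneRestriction

theorem mainTheorem10 (X : Submodule ℝ LOneUnit) :
    (∀ (f : X) (h : StrongDual ℝ X), IsFrakDPoint f → h ∈ supportingFunctionals f →
      ∀ ε δ γ : ℝ, 0 < ε → 0 < δ → 0 < γ →
        ∃ D : Set unitInterval, MeasurableSet D ∧ volume D < ENNReal.ofReal δ ∧
          ∃ g ∈ ballSlice h γ, 1 - ε < ∫ t in D, |(g : LOneUnit) t|) ∧
    (IsReflexiveSpace X →
      ∀ f : X, ¬ IsFrakDPoint f ∧ ¬ IsDeltaPoint f ∧ ¬ IsDaugavetPoint f) := by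
  refine ⟨fun f h hf hh ε δ γ hε hδ hγ => hf.exists_concentrated_mem_slice hh hε hδ hγ,
    fun hX f => ?_⟩
  have hf := hX.not_isFrakDPoint f
  exact ⟨hf, fun hΔ => hf hΔ.isFrakDPoint, fun hD => hf hD.isDeltaPoint.isFrakDPoint⟩
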